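/- Let $E^*=\{(c,e)\in\mathbb{R}^3\times\mathbb{R}^3 : c\cdot e=0,\ |c|>0,\ |e|<1\}$ be the space of Keplerian elliptic orbits with marked pericenter ($c$ is the angular momentum vector and $e$ the Laplace vector of the orbit, and $|\cdot|$ is the Euclidean norm), with the topology induced from $\mathbb{R}^6=\mathbb{R}^3\times\mathbb{R}^3$. Then there is no way to define the structure of a finite-dimensional topological vector space over $\mathbb{R}$ on $E^*$; that is, no finite-dimensional real topological vector space is homeomorphic to $E^*$. -/

import Mathlib

namespace KeplerOrbits

/-- Euclidean three-space `ℝ³`. -/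
abbrev Vec3 : Type := EuclideanSpace ℝ (Fin 3)

/-- The set `ℍ(b)` of curvilinear Keplerian orbits with angular momentum greater than `b`: pairs
`(c, e)` (angular momentum vector, Laplace vector) with `c · e = 0` and `|c| > b`. -/
def curvilinearOrbits (b : ℝ) : Set (Vec3 × Vec3) :=
  {x | inner ℝ x.1 x.2 = 0 ∧ b < ‖x.1‖}

/-- The set `E*` of elliptic orbits with marked pericenter: the pairs `(c, e)` in `ℍ(0)` with
`|e| < 1`. Coerced to a type it carries the topology induced from `ℝ³ × ℝ³ = ℝ⁶`. -/
def ellipticOrbits : Set (Vec3 × Vec3) :=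
  {x | x ∈ curvilinearOrbits 0 ∧ ‖x.2‖ < 1}

end KeplerOrbits

/-! The unit sphere embeds in `ellipticOrbits` as circular orbits, and normalising the angular
momentum inverts this on the left. A homeomorphism onto `V` would transport the contraction `t • v`,
making the identity of the sphere nullhomotopic. Then the tautological line bundle over the sphere
(`lineProj`) would have a nonvanishing section (`exists_section_of_nullhomotopic`), which a winding
number rules out (`not_exists_section`). -/

namespace KeplerOrbits

open unitInterval

/-- The Hermitian matrix `1 + x · σ` (with `σ` the Pauli matrices) applied to a vector of `ℂ²`. For
a unit vector `x` it is twice the projection to the complex line that corresponds to `x` under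
`S² ≃ ℂℙ¹`. -/
noncomputable def lineProj (x : Vec3) (v : ℂ × ℂ) : ℂ × ℂ :=
  ((1 + x 2) * v.1 + (x 0 - Complex.I * x 1) * v.2,
    (x 0 + Complex.I * x 1) * v.1 + (1 - x 2) * v.2)

theorem norm_sq_eq (x : Vec3) : ‖x‖ ^ 2 = x 0 ^ 2 + x 1 ^ 2 + x 2 ^ 2 := by
  rw [EuclideanSpace.norm_sq_eq, Fin.sum_univ_three]
  simp

theorem continuous_lineProj {X : Type*} [TopologicalSpace X] {x : X → Vec3} {v : X → ℂ × ℂ}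
    (hx : Continuous x) (hv : Continuous v) : Continuous fun a ↦ lineProj (x a) (v a) := by
  unfold lineProj
  fun_prop

theorem lineProj_lineProj {x : Vec3} (hx : ‖x‖ = 1) (v : ℂ × ℂ) :
    lineProj x (lineProj x v) = (2 : ℂ) • lineProj x v := by
  have h : (x 0 : ℂ) ^ 2 + (x 1 : ℂ) ^ 2 + (x 2 : ℂ) ^ 2 = 1 := by
    have := norm_sq_eq x
    rw [hx] at this
    exact_mod_cast this.symm.trans (one_pow 2)
  have hI : Complex.I ^ 2 = -1 := Complex.I_sq
  ext
  · simp only [lineProj, Prod.smul_fst, smul_eq_mul]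
    linear_combination v.1 * h - v.1 * (x 1 : ℂ) ^ 2 * hI
  · simp only [lineProj, Prod.smul_snd, smul_eq_mul]
    linear_combination v.2 * h - v.2 * (x 1 : ℂ) ^ 2 * hI

/-- Projecting a nonzero vector of one line to the line of a non-antipodal point gives a nonzero
vector. -/
theorem lineProj_ne_zero {p q : Vec3} (hpq : dist p q < 2) {v : ℂ × ℂ} (hv : v ≠ 0)
    (hp : lineProj p v = (2 : ℂ) • v) : lineProj q v ≠ 0 := by
  intro hq
  have hI : Complex.I ^ 2 = -1 := Complex.I_sq
  simp only [lineProj, Prod.ext_iff, Prod.smul_fst, Prod.smul_snd, smul_eq_mul,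
    Prod.fst_zero, Prod.snd_zero] at hp hq
  obtain ⟨hp₁, hp₂⟩ := hp
  obtain ⟨hq₁, hq₂⟩ := hq
  have hd : ‖p - q‖ ^ 2 < 4 := by
    rw [← dist_eq_norm]
    nlinarith [dist_nonneg (x := p) (y := q)]
  rw [norm_sq_eq] at hd
  simp only [PiLp.sub_apply] at hd
  set a : ℝ := p 0 - q 0 with ha
  set b : ℝ := p 1 - q 1 with hb
  set c : ℝ := p 2 - q 2 with hc
  -- Thus `(p - q) · σ` sends `v` to `2v`, while its square is the scalar `‖p - q‖² < 4`.
  have e₁ : (c : ℂ) * v.1 + (a - Complex.I * b) * v.2 = 2 * v.1 := by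
    rw [ha, hb, hc]; push_cast
    linear_combination hp₁ - hq₁
  have e₂ : (a + Complex.I * b) * v.1 - (c : ℂ) * v.2 = 2 * v.2 := by
    rw [ha, hb, hc]; push_cast
    linear_combination hp₂ - hq₂
  have hne : (4 - ((a ^ 2 + b ^ 2 + c ^ 2 : ℝ) : ℂ)) ≠ 0 := by
    rw [← Complex.ofReal_ofNat, ← Complex.ofReal_sub, Complex.ofReal_ne_zero]
    linarith
  refine hv (Prod.ext ?_ ?_)
  · refine (mul_eq_zero.mp ?_).resolve_left hne
    push_cast
    linear_combination (-2 - c) * e₁ - (a - Complex.I * b) * e₂ - b ^ 2 * v.1 * hI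
  · refine (mul_eq_zero.mp ?_).resolve_left hne
    push_cast
    linear_combination (-2 + c) * e₂ - (a + Complex.I * b) * e₁ - b ^ 2 * v.2 * hI

/-- A map to the sphere that is homotopic to a constant lifts to a nonvanishing section of the
tautological line bundle. -/
theorem exists_section_of_nullhomotopic {X : Type*} [TopologicalSpace X] [CompactSpace X]
    {H : I × X → Vec3} (hH : Continuous H) (hn : ∀ y, ‖H y‖ = 1) {p : Vec3}
    (h₀ : ∀ x, H (0, x) = p) :
    ∃ s : X → ℂ × ℂ, Continuous s ∧ (∀ x, s x ≠ 0) ∧ ∀ x, lineProj (H (1, x)) (s x) = (2 : ℂ) • s x := by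
  -- `C` is clopen: projection carries a section at one time to any time that is nowhere antipodal
  -- to it, and compactness of `X` makes nearby times so.
  let C : Set I := {t | ∃ s : X → ℂ × ℂ, Continuous s ∧ (∀ x, s x ≠ 0) ∧
    ∀ x, lineProj (H (t, x)) (s x) = (2 : ℂ) • s x}
  have hstep (t u : I) (htu : ∀ x, dist (H (t, x)) (H (u, x)) < 2) (ht : t ∈ C) : u ∈ C := by
    obtain ⟨s, hs, hs₀, hs₁⟩ := ht
    exact ⟨fun x ↦ lineProj (H (u, x)) (s x), continuous_lineProj (by fun_prop) hs,
      fun x ↦ lineProj_ne_zero (htu x) (hs₀ x) (hs₁ x), fun x ↦ lineProj_lineProj (hn _) _⟩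
  have hnear (t : I) : ∀ᶠ u in nhds t, ∀ x, dist (H (t, x)) (H (u, x)) < 2 := by
    simpa using isCompact_univ.eventually_forall_of_forall_eventually (P := fun u x ↦
      dist (H (t, x)) (H (u, x)) < 2) (fun x _ ↦ by
        have hc : Continuous fun y : I × X ↦ dist (H (t, y.2)) (H (y.1, y.2)) := by fun_prop
        exact hc.continuousAt.eventually_lt continuousAt_const (by simp))
  have hC : IsClopen C := by
    constructor
    · rw [← isOpen_compl_iff, isOpen_iff_mem_nhds]
      intro t ht
      filter_upwards [hnear t] with u hu huC
      exact ht (hstep u t (fun x ↦ by rw [dist_comm]; exact hu x) huC)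
    · rw [isOpen_iff_mem_nhds]
      intro t ht
      filter_upwards [hnear t] with u hu
      exact hstep t u hu ht
  have hp : (0 : I) ∈ C := by
    rcases isEmpty_or_nonempty X with hX | ⟨⟨x₀⟩⟩
    · exact ⟨fun _ ↦ 0, continuous_const, fun x ↦ hX.elim x, fun x ↦ hX.elim x⟩
    · have hp₁ : ‖p‖ = 1 := h₀ x₀ ▸ hn _
      -- The matrix is nonzero since its trace is 2.
      obtain ⟨v, hv⟩ : ∃ v, lineProj p v ≠ 0 := by
        by_contra! hv
        have h₁ := congrArg Prod.fst (hv (1, 0))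
        have h₂ := congrArg Prod.snd (hv (0, 1))
        simp only [lineProj, mul_one, mul_zero, add_zero, zero_add, Prod.fst_zero,
          Prod.snd_zero] at h₁ h₂
        exact two_ne_zero (α := ℂ) (by linear_combination h₁ + h₂)
      exact ⟨fun _ ↦ lineProj p v, continuous_const, fun _ ↦ hv, fun x ↦ by
        rw [h₀]; exact lineProj_lineProj hp₁ _⟩
  have h₁ : (1 : I) ∈ C := by
    rw [hC.eq_univ ⟨0, hp⟩]
    trivial
  exact h₁

/-- A continuous nonvanishing function on the plane does not restrict to a multiple of the identity
on the unit circle. -/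
theorem not_exists_nonvanishing_extension {f : ℂ → ℂ} (hf : Continuous f) (h₀ : ∀ z, f z ≠ 0)
    {w : ℂ} (hw : ∀ z, ‖z‖ = 1 → f z = z * w) : False := by
  obtain ⟨g, ⟨-, hg⟩, -⟩ := Complex.isCoveringMap_exp.existsUnique_continuousMap_lifts
    (⟨fun z ↦ ⟨f z, h₀ z⟩, by fun_prop⟩ : C(ℂ, {z : ℂ // z ≠ 0})) 0 (Complex.log (f 0))
    (Subtype.ext (Complex.exp_log (h₀ 0)))
  have hg' (z : ℂ) : Complex.exp (g z) = f z := congrArg Subtype.val (congrFun hg z)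
  have hw₀ : w ≠ 0 := fun h ↦ h₀ 1 (by rw [hw 1 (by simp), h, mul_zero])
  -- `k` is a continuous logarithm of the constant `w`, hence constant; yet it drops by `2πi` over a
  -- full turn.
  let k : ℝ → ℂ := fun θ ↦ g (Complex.exp (θ * Complex.I)) - θ * Complex.I
  have hk (θ : ℝ) : Complex.exp (k θ) = w := by
    rw [Complex.exp_sub, hg', hw _ (Complex.norm_exp_ofReal_mul_I θ),
      mul_div_cancel_left₀ _ (Complex.exp_ne_zero _)]
  have hkc : Continuous k := by fun_prop
  have := congrFun (Complex.isCoveringMap_exp.eq_of_comp_eq hkc (continuous_const (y := k 0))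
    (funext fun θ ↦ Subtype.ext ((hk θ).trans (hk 0).symm)) 0 rfl) (2 * Real.pi)
  simp only [k, Complex.ofReal_mul, Complex.ofReal_ofNat, Complex.exp_two_pi_mul_I,
    Complex.ofReal_zero, zero_mul, Complex.exp_zero, sub_zero, sub_eq_self] at this
  exact Complex.two_pi_I_ne_zero this

/-- The point of the sphere whose line is spanned by the vector `(z, r)` of `ℂ²`. -/
noncomputable def hopfPoint (z : ℂ) (r : ℝ) : Vec3 :=
  !₂[2 * r * z.re, -(2 * r * z.im), Complex.normSq z - r ^ 2]

theorem norm_hopfPoint {z : ℂ} {r : ℝ} (h : Complex.normSq z + r ^ 2 = 1) :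
    ‖hopfPoint z r‖ = 1 := by
  have : ‖hopfPoint z r‖ ^ 2 = 1 := by
    rw [norm_sq_eq]
    simp only [hopfPoint, Matrix.cons_val]
    rw [Complex.normSq_apply] at *
    linear_combination (z.re * z.re + z.im * z.im + r ^ 2 + 1) * h
  exact (pow_eq_one_iff_of_nonneg (norm_nonneg _) two_ne_zero).mp this

/-- For the unit vector `u = (z, r)`, the matrix `1 + x · σ` is `2uu*`. -/
theorem lineProj_hopfPoint {z : ℂ} {r : ℝ} (h : Complex.normSq z + r ^ 2 = 1) (v : ℂ × ℂ) :
    lineProj (hopfPoint z r) v =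
      (2 * (starRingEnd ℂ z * v.1 + r * v.2) * z, 2 * (starRingEnd ℂ z * v.1 + r * v.2) * r) := by
  have h' : z * starRingEnd ℂ z + (r : ℂ) ^ 2 = 1 := by
    rw [Complex.mul_conj]; exact_mod_cast h
  have hz : (z.re : ℂ) - Complex.I * (-z.im) = z := by
    conv_rhs => rw [← Complex.re_add_im z]
    ring
  have hz' : (z.re : ℂ) + Complex.I * (-z.im) = starRingEnd ℂ z := by
    apply Complex.ext <;> simp
  simp only [lineProj, hopfPoint, Matrix.cons_val]
  push_cast
  rw [← Complex.mul_conj]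
  ext
  · linear_combination -v.1 * h' + 2 * r * v.2 * hz
  · linear_combination -v.2 * h' + 2 * r * v.1 * hz'

theorem not_exists_section {s : Metric.sphere (0 : Vec3) 1 → ℂ × ℂ} (hs : Continuous s)
    (h₀ : ∀ x, s x ≠ 0) (h : ∀ x : Metric.sphere (0 : Vec3) 1, lineProj x (s x) = (2 : ℂ) • s x) :
    False := by
  -- Radial retraction to the closed disc, which `hopfPoint` maps to the sphere, collapsing the
  -- boundary circle to the north pole.
  let ρ : ℂ → ℂ := fun z ↦ z / (max 1 ‖z‖ : ℝ)
  have hm (z : ℂ) : 0 < max 1 ‖z‖ := lt_max_of_lt_left one_pos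
  have hρc : Continuous ρ := Continuous.div₀ continuous_id (by fun_prop)
    fun z ↦ Complex.ofReal_ne_zero.mpr (hm z).ne'
  have hρ (z : ℂ) : Complex.normSq (ρ z) ≤ 1 := by
    rw [Complex.normSq_eq_norm_sq]
    refine pow_le_one₀ (norm_nonneg _) ?_
    rw [norm_div, Complex.norm_real, Real.norm_of_nonneg (hm z).le]
    exact div_le_one_of_le₀ (le_max_right _ _) (hm z).le
  let r : ℂ → ℝ := fun z ↦ √(1 - Complex.normSq (ρ z))
  have hr (z : ℂ) : Complex.normSq (ρ z) + r z ^ 2 = 1 := by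
    rw [Real.sq_sqrt (sub_nonneg.mpr (hρ z))]
    ring
  have hrc : Continuous r := (continuous_const.sub (Complex.continuous_normSq.comp hρc)).sqrt
  let x : ℂ → Metric.sphere (0 : Vec3) 1 := fun z ↦
    ⟨hopfPoint (ρ z) (r z), mem_sphere_zero_iff_norm.mpr (norm_hopfPoint (hr z))⟩
  have hxc : Continuous x := by
    refine Continuous.subtype_mk ?_ _
    unfold hopfPoint
    refine (PiLp.continuous_toLp 2 _).comp (continuous_pi fun i ↦ ?_)
    have := Complex.continuous_normSq.comp hρc
    have := Complex.continuous_re.comp hρc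
    have := Complex.continuous_im.comp hρc
    fin_cases i <;> simp <;> fun_prop
  -- The section's coefficient along `(ρ z, r z)`, conjugated so that it is `z` times a constant on
  -- the unit circle.
  let f : ℂ → ℂ := fun z ↦ starRingEnd ℂ (starRingEnd ℂ (ρ z) * (s (x z)).1 + r z * (s (x z)).2)
  let n : Metric.sphere (0 : Vec3) 1 := x 1
  refine not_exists_nonvanishing_extension (f := f) (w := starRingEnd ℂ (s n).1) ?_ ?_ ?_
  · exact Complex.continuous_conj.comp (by fun_prop)
  · intro z hz
    have h1 := h (x z)
    rw [lineProj_hopfPoint (hr z), (map_eq_zero _).mp hz] at h1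
    refine h₀ (x z) ?_
    simpa [Prod.ext_iff, eq_comm] using h1
  · intro z hz
    have hρz (z : ℂ) (hz : ‖z‖ = 1) : ρ z = z := by simp [ρ, hz]
    have hrz (z : ℂ) (hz : ‖z‖ = 1) : r z = 0 := by
      simp [r, hρz z hz, Complex.normSq_eq_norm_sq, hz]
    have hx : x z = n := by
      refine Subtype.ext ?_
      simp [n, x, hρz z hz, hrz z hz, hρz 1 (by simp), hrz 1 (by simp), hopfPoint,
        Complex.normSq_eq_norm_sq, hz]
    simp [f, hx, hρz z hz, hrz z hz]

/-- The two-sphere is not contractible. -/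
theorem sphere_not_nullhomotopic {H : I × Metric.sphere (0 : Vec3) 1 → Metric.sphere (0 : Vec3) 1}
    (hH : Continuous H) {p : Metric.sphere (0 : Vec3) 1} (h₀ : ∀ x, H (0, x) = p)
    (h₁ : ∀ x, H (1, x) = x) : False := by
  obtain ⟨s, hs, hs₀, hs₁⟩ := exists_section_of_nullhomotopic (H := fun y ↦ (H y : Vec3))
    (continuous_subtype_val.comp hH) (fun y ↦ mem_sphere_zero_iff_norm.mp (H y).2)
    (fun x ↦ congrArg Subtype.val (h₀ x))
  exact not_exists_section hs hs₀ fun x ↦ by simpa only [h₁] using hs₁ x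

/-- The direction of the angular momentum. -/
noncomputable def angularDirection (x : ellipticOrbits) : Metric.sphere (0 : Vec3) 1 :=
  ⟨‖x.1.1‖⁻¹ • x.1.1, by
    rw [mem_sphere_zero_iff_norm, norm_smul, norm_inv, norm_norm,
      inv_mul_cancel₀ (show (0 : ℝ) < ‖x.1.1‖ from x.2.1.2).ne']⟩

/-- The circular orbit whose angular momentum is a given unit vector. -/
def circularOrbit (c : Metric.sphere (0 : Vec3) 1) : ellipticOrbits :=
  ⟨(c, 0), ⟨inner_zero_right _, by simp⟩, by simp⟩

theorem continuous_angularDirection : Continuous angularDirection := by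
  have hc : Continuous fun x : ellipticOrbits ↦ x.1.1 := by fun_prop
  exact ((hc.norm.inv₀ fun x ↦ (show (0 : ℝ) < ‖x.1.1‖ from x.2.1.2).ne').smul hc).subtype_mk _

theorem continuous_circularOrbit : Continuous circularOrbit := by
  unfold circularOrbit
  fun_prop

theorem angularDirection_circularOrbit (c : Metric.sphere (0 : Vec3) 1) :
    angularDirection (circularOrbit c) = c := by
  simp [angularDirection, circularOrbit]

end KeplerOrbits

open KeplerOrbits unitInterval in
theorem theorem3 (V : Type*) [AddCommGroup V] [Module ℝ V] [TopologicalSpace V]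
    [IsTopologicalAddGroup V] [ContinuousSMul ℝ V] [FiniteDimensional ℝ V] :
    ¬ Nonempty (KeplerOrbits.ellipticOrbits ≃ₜ V) := by
  rintro ⟨h⟩
  refine sphere_not_nullhomotopic
    (H := fun y ↦ angularDirection (h.symm ((y.1 : ℝ) • h (circularOrbit y.2)))) ?_
    (p := angularDirection (h.symm 0)) (fun x ↦ by simp) (fun x ↦ ?_)
  · have := continuous_angularDirection
    have := continuous_circularOrbit
    fun_prop
  · simp [angularDirection_circularOrbit]
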